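/- Let $\mathcal C$ be a small additive category, and let $\operatorname{Mod}\text{-}\mathcal C$ be the abelian category of additive functors $\mathcal C^{op}\to \mathrm{Ab}$ (right $\mathcal C$-modules). A module $M$ is of type $\mathcal{FP}_0$ (finitely generated) if it is a quotient of a finite direct sum of representable modules $\hom_{\mathcal C}(-,c)$, and of type $\mathcal{FP}_1$ if $\operatorname{Hom}(M,-)$ preserves direct limits. The category $\mathcal C$ is right Noetherian if every submodule of a module of type $\mathcal{FP}_0$ is of type $\mathcal{FP}_0$. It is right regular coherent if every submodule of type $\mathcal{FP}_0$ of a module of type $\mathcal{FP}_1$ is of type $\mathcal{FP}_1$, and every module of type $\mathcal{FP}_1$ has finite projective dimension. It is right regular if it is right Noetherian and right regular coherent. For morphisms $f:a\to c$ and $f':a'\to c$ write $f\subseteq f'$ if $f=f'\circ g$ for some $g:a\to a'$. A pseudo $\infty$-kernel of $f:x\to y$ is a sequence of morphisms $(\dots,f_2,f_1)$ forming a chain $\cdots\to x_2\xrightarrow{f_2}x_1\xrightarrow{f_1}x_0=x\xrightarrow{f_0=f}x_{-1}=y$ such that $\cdots\to\hom_{\mathcal C}(-,x_1)\to\hom_{\mathcal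 C}(-,x_0)\to\hom_{\mathcal C}(-,x_{-1})$ is exact. Then the following are equivalent: 1. $\mathcal C$ is right regular. 2. Both of the following conditions hold in $\mathcal C$: (i) for every object $c$, every nonempty directed set $I$ and every family of morphisms $\{f_i:a_i\to c\}_{i\in I}$ with $f_i\subseteq f_j$ whenever $i\le j$, there exists $i_0\in I$ with $f_i\subseteq f_{i_0}$ for all $i\in I$; (ii) for every morphism $f=f_0:x\to y$ and every pseudo $\infty$-kernel $(\dots,f_2,f_1)$ of $f$ there exist an integer $k\ge 1$ and an endomorphism $\alpha:x_{k-1}\to x_{k-1}$ with $f_{k-1}\circ\alpha=f_{k-1}$ and $\alpha\circ f_k=0$. -/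

import Mathlib

open CategoryTheory CategoryTheory.Limits

universe u

namespace RightRegular

/-! ### The abelian category of right modules over a small preadditive category -/

section ClosureProperties

variable (A : Type u) [SmallCategory A] [Preadditive A]

instance additiveFunctor_isClosedUnderSubobjects :
    (additiveFunctor A AddCommGrpCat.{u}).IsClosedUnderSubobjects where
  prop_of_mono {F G} i _ hG := by
    have : G.Additive := hG
    refine (additiveFunctor_iff F).2 ⟨fun {X Y f g} => ?_⟩
    rw [← cancel_mono (i.app Y)]
    simp [Preadditive.add_comp, Preadditive.comp_add, Functor.map_add]

instance additiveFunctor_isClosedUnderQuotients :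
    (additiveFunctor A AddCommGrpCat.{u}).IsClosedUnderQuotients where
  prop_of_epi {F G} p _ hF := by
    have : F.Additive := hF
    refine (additiveFunctor_iff G).2 ⟨fun {X Y f g} => ?_⟩
    rw [← cancel_epi (p.app X), ← p.naturality, Functor.map_add]
    simp [Preadditive.add_comp, Preadditive.comp_add]

instance additiveFunctor_containsZero :
    (additiveFunctor A AddCommGrpCat.{u}).ContainsZero where
  exists_zero := ⟨_, isZero_zero _,
    (additiveFunctor_iff _).2 ⟨fun {X _ _ _} =>
      ((isZero_zero (A ⥤ AddCommGrpCat.{u})).obj X).eq_of_src _ _⟩⟩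

instance additiveFunctor_isClosedUnderFiniteProducts :
    (additiveFunctor A AddCommGrpCat.{u}).IsClosedUnderFiniteProducts where
  isClosedUnderLimitsOfShape J _ :=
    { limitsOfShape_le := by
        rintro F ⟨P⟩
        refine (additiveFunctor_iff F).2 ⟨fun {X Y f g} => ?_⟩
        refine (isLimitOfPreserves ((evaluation A AddCommGrpCat.{u}).obj Y)
          P.isLimit).hom_ext fun j => ?_
        have : (P.diag.obj j).Additive := P.prop_diag_obj j
        have h : ∀ t : X ⟶ Y, F.map t ≫ (P.π.app j).app Y =
            (P.π.app j).app X ≫ (P.diag.obj j).map t := fun t => (P.π.app j).naturality t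
        change F.map (f + g) ≫ (P.π.app j).app Y = (F.map f + F.map g) ≫ (P.π.app j).app Y
        rw [Preadditive.add_comp, h, h, h, Functor.map_add, Preadditive.comp_add] }

end ClosureProperties

section Modules

variable (C : Type u) [SmallCategory C] [Preadditive C]

/-- The category of right `C`-modules: additive functors `Cᵒᵖ ⥤ Ab` and natural
transformations. -/
abbrev RightModule : Type (u + 1) := Cᵒᵖ ⥤+ AddCommGrpCat.{u}

variable {C}

/-- The representable right module `hom(-, c)`. -/
noncomputable def representable (c : C) : RightModule C :=
  AdditiveFunctor.of (preadditiveYoneda.obj c)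

/-- Type `FP₀`: finitely generated, that is, a quotient of a finite direct sum of representable
modules. -/
def IsTypeFPZero (M : RightModule C) : Prop :=
  ∃ (n : ℕ) (c : Fin n → C) (p : (∐ fun j => representable (c j)) ⟶ M), Epi p

/-- Type `FP₁`: the functor `Hom(M, -) = Ext⁰(M, -)` preserves direct limits. -/
def IsTypeFPOne (M : RightModule C) : Prop :=
  IsFinitelyPresentable.{u} M

/-- A `0`-coherent, or Noetherian, module: it is finitely generated and so is each of its
subobjects. -/
def IsZeroCoherentModule (M : RightModule C) : Prop :=
  IsTypeFPZero M ∧ ∀ (S : RightModule C) (i : S ⟶ M), Mono i → IsTypeFPZero S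

/-- A `1`-coherent module: it is of type `FP₁`, and each of its subobjects of type `FP₀` is of
type `FP₁`. -/
def IsOneCoherentModule (M : RightModule C) : Prop :=
  IsTypeFPOne M ∧
    ∀ (S : RightModule C) (i : S ⟶ M), Mono i → IsTypeFPZero S → IsTypeFPOne S

/-- Finite projective dimension: for some `n`, `Ext^i(M, -) = 0` for all `i ≥ n`. -/
def HasFiniteProjectiveDimension (M : RightModule C) : Prop :=
  ∃ n : ℕ, HasProjectiveDimensionLT M n

variable (C)

/-- `C` is right Noetherian, i.e. right `0`-coherent. -/
def IsRightNoetherian : Prop :=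
  ∀ M : RightModule C, IsTypeFPZero M → IsZeroCoherentModule M

/-- `C` is right coherent, i.e. right `1`-coherent. -/
def IsRightCoherent : Prop :=
  ∀ M : RightModule C, IsTypeFPOne M → IsOneCoherentModule M

/-- `C` is right regular coherent: it is right coherent, and each module of type `FP₁` has finite
projective dimension. -/
def IsRightRegularCoherent : Prop :=
  IsRightCoherent C ∧ ∀ M : RightModule C, IsTypeFPOne M → HasFiniteProjectiveDimension M

/-- `C` is right regular: right Noetherian and right regular coherent. -/
def IsRightRegular : Prop :=
  IsRightNoetherian C ∧ IsRightRegularCoherent C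

end Modules

/-! ### The intrinsic conditions -/

section Intrinsic

variable {C : Type u} [SmallCategory C]

/-- For morphisms `f : a ⟶ c` and `g : b ⟶ c` with the same target, `f ⊆ g` means that `f` factors
through `g`. -/
def FactorsThrough {a b c : C} (f : a ⟶ c) (g : b ⟶ c) : Prop :=
  ∃ t : a ⟶ b, t ≫ g = f

/-- Each nonempty directed family of morphisms into `c`, increasing for `⊆`, has a largest
member. -/
def HasDirectedACC (c : C) : Prop :=
  ∀ (I : Type u) [Preorder I] [IsDirectedOrder I] [Nonempty I] (a : I → C) (f : ∀ i, a i ⟶ c),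
    (∀ i j, i ≤ j → FactorsThrough (f i) (f j)) → ∃ i₀, ∀ i, FactorsThrough (f i) (f i₀)

variable [Preadditive C]

/-- `g : k ⟶ x` is a pseudo-kernel of `f : x ⟶ y`:
`hom(-, k) → hom(-, x) → hom(-, y)` is exact. -/
def IsPseudoKernel {k x y : C} (g : k ⟶ x) (f : x ⟶ y) : Prop :=
  ∀ c : C, Function.Exact (fun t : c ⟶ k => t ≫ g) (fun h : c ⟶ x => h ≫ f)

/-- For a chain `⋯ ⟶ X 3 ⟶ X 2 ⟶ X 1 ⟶ X 0` with `f n : X (n + 1) ⟶ X n`: the sequence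
`(…, f 3, f 2, f 1)` is a pseudo `∞`-kernel of the morphism `f 0 : X 1 ⟶ X 0`, i.e. the sequence
`⋯ → hom(-, X 2) → hom(-, X 1) → hom(-, X 0)` is exact. The usual notation is `y = X 0` and
`x_n = X (n + 1)`, so that `f 0 : x_0 ⟶ y` and `f n : x_n ⟶ x_{n-1}` for `n ≥ 1`. -/
def IsPseudoInfinityKernel (X : ℕ → C) (f : ∀ n, X (n + 1) ⟶ X n) : Prop :=
  ∀ n, IsPseudoKernel (f (n + 1)) (f n)

variable (C)

/-- The splitting condition: for every morphism `f 0` with a pseudo `∞`-kernel `(…, f 2, f 1)` there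
are `k ≥ 1` and an endomorphism `α` of `x_{k-1} = X k` with `f_{k-1} ∘ α = f_{k-1}` and
`α ∘ f_k = 0`. -/
def AlphaSplitting : Prop :=
  ∀ (X : ℕ → C) (f : ∀ n, X (n + 1) ⟶ X n), IsPseudoInfinityKernel X f →
    ∃ (m : ℕ) (α : X (m + 1) ⟶ X (m + 1)), α ≫ f m = f m ∧ f (m + 1) ≫ α = 0

end Intrinsic

end RightRegular

/-! Representables are projective and finitely presentable by Yoneda, and biproducts in `C` make
every finitely generated module a quotient of a single one. Morphisms into `c`, preordered by `⊆`,
describe the cyclic submodules of `hom(-, c)`. Condition (i) is therefore the ascending chain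
condition, i.e. right Noetherian: `isTypeFPZero_of_mono_representable` and
`IsRightNoetherian.hasDirectedACC`. In the Noetherian case `FP₀` and `FP₁` agree, so coherence is
automatic and only finite projective dimension remains. An `FP₁` module is then the cokernel of some
`f 0` between representables, and a pseudo `∞`-kernel of `f 0` is a projective resolution of it. By
dimension shifting, its dimension is at most `n` iff `coker (f n)` is projective. For `n = m + 1`
this cokernel is the image of `f m`, and a splitting of the projection onto it is an `α` as in (ii)
(`projective_iff`). -/

namespace RightRegular

open Opposite ZeroObject

/-! ### Yoneda: representables are projective and finitely presentable. -/

section Representables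

variable {C : Type u} [SmallCategory C] [Preadditive C]

/-- The embedding of `C` into the category of right `C`-modules. -/
noncomputable def representableFunctor (C : Type u) [SmallCategory C] [Preadditive C] :
    C ⥤ RightModule C :=
  (additiveFunctor Cᵒᵖ AddCommGrpCat.{u}).lift preadditiveYoneda fun _ => additive_yonedaObj' _

/-- The map between representable modules induced by a morphism of `C`. -/
noncomputable def representableMap {a b : C} (f : a ⟶ b) : representable a ⟶ representable b :=
  (representableFunctor C).map f

@[simp]
theorem representableMap_id (a : C) : representableMap (𝟙 a) = 𝟙 (representable a) :=
  (representableFunctor C).map_id a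

@[simp]
theorem representableMap_comp {a b c : C} (f : a ⟶ b) (g : b ⟶ c) :
    representableMap (f ≫ g) = representableMap f ≫ representableMap g :=
  (representableFunctor C).map_comp f g

instance : (preadditiveYoneda : C ⥤ Cᵒᵖ ⥤ AddCommGrpCat.{u}).Additive where
  map_add {X Y f g} := by
    ext Z h
    exact Preadditive.comp_add _ _ _ h f g

theorem representableMap_add {a b : C} (f g : a ⟶ b) :
    representableMap (f + g) = representableMap f + representableMap g :=
  ObjectProperty.hom_ext _ (Functor.map_add (preadditiveYoneda (C := C)))

theorem representableMap_injective {a b : C} :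
    Function.Injective (representableMap : (a ⟶ b) → (representable a ⟶ representable b)) :=
  fun _ _ h => (preadditiveYoneda (C := C)).map_injective (congrArg (·.hom) h)

theorem representableMap_surjective {a b : C} :
    Function.Surjective (representableMap : (a ⟶ b) → (representable a ⟶ representable b)) := by
  intro h
  obtain ⟨f, hf⟩ := (preadditiveYoneda (C := C)).map_surjective h.hom
  exact ⟨f, ObjectProperty.hom_ext _ hf⟩

/-- The Yoneda lemma for right modules. -/
noncomputable def representableHomEquiv (c : C) (M : RightModule C) :
    (representable c ⟶ M) ≃ (M.obj.obj (op c) : Type u) where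
  toFun f := (f.hom.app (op c)).hom (𝟙 c)
  invFun m := ObjectProperty.homMk
    { app := fun x => AddCommGrpCat.ofHom
        (AddMonoidHom.mk' (fun t : x.unop ⟶ c => (M.obj.map t.op).hom m) fun s t => by
          change (M.obj.map (s.op + t.op)).hom m = _
          rw [Functor.map_add]
          rfl)
      naturality := fun x y g => by
        ext t
        exact ConcreteCategory.congr_hom (M.obj.map_comp (Quiver.Hom.op t) g) m }
  left_inv f := by
    apply ObjectProperty.hom_ext
    ext x t
    change (M.obj.map t.op).hom ((f.hom.app (op c)).hom (𝟙 c)) = (f.hom.app x).hom t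
    have h := ConcreteCategory.congr_hom (f.hom.naturality (Quiver.Hom.op t)) (𝟙 c)
    refine h.symm.trans ?_
    exact congrArg (f.hom.app x).hom (Category.comp_id (show x.unop ⟶ c from t))
  right_inv m := by
    change (M.obj.map (𝟙 (op c))).hom m = m
    simp

theorem representableHomEquiv_comp {c : C} {M N : RightModule C} (x : representable c ⟶ M)
    (f : M ⟶ N) : representableHomEquiv c N (x ≫ f) =
      (f.hom.app (op c)).hom (representableHomEquiv c M x) :=
  rfl

theorem hom_ext_of_representable {M N : RightModule C} {f g : M ⟶ N}
    (h : ∀ (c : C) (x : representable c ⟶ M), x ≫ f = x ≫ g) : f = g := by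
  apply ObjectProperty.hom_ext
  ext c m
  obtain ⟨x, rfl⟩ := (representableHomEquiv c.unop M).surjective m
  exact congrArg (representableHomEquiv c.unop N) (h c.unop x)

theorem epi_of_representable_lift {M N : RightModule C} (p : M ⟶ N)
    (h : ∀ (c : C) (x : representable c ⟶ N), ∃ y, y ≫ p = x) : Epi p where
  left_cancellation f g hfg := by
    refine hom_ext_of_representable fun c x => ?_
    obtain ⟨y, rfl⟩ := h c x
    rw [Category.assoc, hfg, Category.assoc]

instance representable_projective (c : C) : Projective (representable c) where
  factors {M N} x p hp := by
    -- Epimorphisms of modules are pointwise surjective, so lifting `x` amounts to lifting one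
    -- element.
    have : (additiveFunctor Cᵒᵖ AddCommGrpCat.{u}).ι.PreservesEpimorphisms :=
      ObjectProperty.preservesEpimorphisms_ι_of_isNormalMonoCategory _
    have hp' : Epi p.hom :=
      inferInstanceAs (Epi ((additiveFunctor Cᵒᵖ AddCommGrpCat.{u}).ι.map p))
    have hpc := (AddCommGrpCat.epi_iff_surjective _).1 ((NatTrans.epi_iff_epi_app _).1 hp' (op c))
    obtain ⟨m, hm⟩ := hpc (representableHomEquiv c _ x)
    refine ⟨(representableHomEquiv c _).symm m, (representableHomEquiv c _).injective ?_⟩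
    rw [representableHomEquiv_comp, Equiv.apply_symm_apply]
    exact hm

/-- Makes colimits of modules pointwise, so that evaluation at an object preserves filtered
colimits. -/
instance additiveFunctor_isClosedUnderColimitsOfShape (A : Type u) [SmallCategory A]
    [Preadditive A] (J : Type u) [SmallCategory J] :
    (additiveFunctor A AddCommGrpCat.{u}).IsClosedUnderColimitsOfShape J where
  colimitsOfShape_le := by
    rintro F ⟨P⟩
    refine (additiveFunctor_iff F).2 ⟨fun {X Y f g} => ?_⟩
    refine (isColimitOfPreserves ((evaluation A AddCommGrpCat.{u}).obj X)
      P.isColimit).hom_ext fun j => ?_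
    have : (P.diag.obj j).Additive := P.prop_diag_obj j
    have h : ∀ t : X ⟶ Y, (P.ι.app j).app X ≫ F.map t =
        (P.diag.obj j).map t ≫ (P.ι.app j).app Y := fun t => ((P.ι.app j).naturality t).symm
    change (P.ι.app j).app X ≫ F.map (f + g) = (P.ι.app j).app X ≫ (F.map f + F.map g)
    rw [Preadditive.comp_add, h, h, h, Functor.map_add, Preadditive.add_comp]

theorem representable_isTypeFPOne (c : C) : IsTypeFPOne (representable c) := by
  let e : coyoneda.obj (op (representable c)) ≅
      (additiveFunctor Cᵒᵖ AddCommGrpCat.{u}).ι ⋙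
        (evaluation Cᵒᵖ AddCommGrpCat.{u}).obj (op c) ⋙ forget AddCommGrpCat.{u} :=
    NatIso.ofComponents (fun M => (representableHomEquiv c M).toIso) fun f => rfl
  refine isFinitelyPresentable_iff_preservesFilteredColimitsOfSize.2 ⟨fun J _ _ => ?_⟩
  exact preservesColimitsOfShape_of_natIso e.symm

end Representables

/-! ### Finitely generated and finitely presentable modules. -/

section FinitenessConditions

variable {C : Type u} [SmallCategory C] [Preadditive C]

theorem IsTypeFPZero.of_epi {M N : RightModule C} (hM : IsTypeFPZero M) (f : M ⟶ N) [Epi f] :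
    IsTypeFPZero N := by
  obtain ⟨n, c, p, _⟩ := hM
  exact ⟨n, c, p ≫ f, epi_comp _ _⟩

theorem isTypeFPZero_of_epi_representable {M : RightModule C} {c : C} (p : representable c ⟶ M)
    [Epi p] : IsTypeFPZero M := by
  refine ⟨1, fun _ => c, Sigma.desc fun _ => p, ?_⟩
  have : Epi (Sigma.ι (fun _ : Fin 1 => representable c) 0 ≫ Sigma.desc fun _ => p) := by
    rwa [Sigma.ι_desc]
  exact epi_of_epi (Sigma.ι (fun _ : Fin 1 => representable c) 0) _

theorem representable_isTypeFPZero (c : C) : IsTypeFPZero (representable c) :=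
  isTypeFPZero_of_epi_representable (𝟙 (representable c))

theorem exists_representable_lift {M N : RightModule C} (p : M ⟶ N) [Epi p] {c : C}
    (x : representable c ⟶ N) : ∃ y, y ≫ p = x :=
  ⟨Projective.factorThru x p, Projective.factorThru_comp x p⟩


/-- The generalized elements of a module `M`, ordered by inclusion of the submodules which they
generate. -/
structure GeneralizedElement (M : RightModule C) : Type u where
  /-- The object at which the element lives. -/
  obj : C
  /-- The morphism which corresponds to the element. -/
  hom : representable obj ⟶ M

instance (M : RightModule C) : Preorder (GeneralizedElement M) where
  le x y := ∃ t, t ≫ y.hom = x.hom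
  le_refl x := ⟨𝟙 _, Category.id_comp _⟩
  le_trans := by
    rintro x y z ⟨s, hs⟩ ⟨t, ht⟩
    exact ⟨s ≫ t, by rw [Category.assoc, ht, hs]⟩

theorem GeneralizedElement.le_iff {M : RightModule C} {x y : GeneralizedElement M} :
    x ≤ y ↔ ∃ t, t ≫ y.hom = x.hom :=
  Iff.rfl

theorem GeneralizedElement.comp_cokernel_eq_zero {M : RightModule C} {x y : GeneralizedElement M}
    (h : x ≤ y) : x.hom ≫ cokernel.π y.hom = 0 := by
  obtain ⟨t, ht⟩ := h
  rw [← ht, Category.assoc, cokernel.condition, comp_zero]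

/-- The quotients of a module by its cyclic submodules. -/
noncomputable def cyclicQuotients (M : RightModule C) : GeneralizedElement M ⥤ RightModule C where
  obj x := cokernel x.hom
  map f := cokernel.desc _ (cokernel.π _) (GeneralizedElement.comp_cokernel_eq_zero (leOfHom f))
  map_id x := (cancel_epi (cokernel.π x.hom)).1 (by simp)
  map_comp f g := (cancel_epi (cokernel.π (GeneralizedElement.hom _))).1 (by simp)

/-- The projection of a module to its quotient by a cyclic submodule. -/
noncomputable def cyclicQuotientsπ {M : RightModule C} (x : GeneralizedElement M) :
    M ⟶ (cyclicQuotients M).obj x :=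
  cokernel.π x.hom

instance {M : RightModule C} (x : GeneralizedElement M) : Epi (cyclicQuotientsπ x) :=
  inferInstanceAs (Epi (cokernel.π x.hom))

theorem cyclicQuotientsπ_map {M : RightModule C} {x y : GeneralizedElement M} (f : x ⟶ y) :
    cyclicQuotientsπ x ≫ (cyclicQuotients M).map f = cyclicQuotientsπ y :=
  cokernel.π_desc _ _ _

theorem comp_cyclicQuotientsπ {M : RightModule C} {x y : GeneralizedElement M} (h : x ≤ y) :
    x.hom ≫ cyclicQuotientsπ y = 0 :=
  GeneralizedElement.comp_cokernel_eq_zero h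

/-- The cocone on the quotients of a module by its cyclic submodules with the zero vertex. -/
noncomputable def cyclicQuotientsCocone (M : RightModule C) : Cocone (cyclicQuotients M) where
  pt := 0
  ι := { app := fun _ => 0 }

theorem isTypeFPOne_cokernel {a b : C} (f : representable a ⟶ representable b) :
    IsTypeFPOne (cokernel f) := by
  have : Fact Cardinal.aleph0.{u}.IsRegular := Cardinal.fact_isRegular_aleph0
  have := representable_isTypeFPOne a
  have := representable_isTypeFPOne b
  have : ∀ k, IsFinitelyPresentable.{u} ((parallelPair f 0).obj k) := by
    rintro (_ | _) <;> assumption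
  exact isCardinalPresentable_of_isColimit' _ (colimit.isColimit (parallelPair f 0))
    Cardinal.aleph0.{u} (hasCardinalLT_of_finite _ _ le_rfl)

theorem representableMap_zero (a b : C) : representableMap (0 : a ⟶ b) = 0 := by
  simpa using representableMap_add (0 : a ⟶ b) 0

theorem isPseudoKernel_iff {k x y : C} (g : k ⟶ x) (f : x ⟶ y) :
    IsPseudoKernel g f ↔ g ≫ f = 0 ∧ ∀ (c : C) (h : c ⟶ x), h ≫ f = 0 → ∃ t, t ≫ g = h := by
  refine ⟨fun h => ⟨?_, fun c t ht => (h c t).1 ht⟩, fun ⟨h₀, h⟩ c t => ⟨h c t, ?_⟩⟩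
  · simpa using (h k g).2 ⟨𝟙 k, Category.id_comp g⟩
  · rintro ⟨s, rfl⟩
    simp [h₀]

/-- Representables are projective and detect epimorphisms, so exactness may be tested on maps out of
them. -/
theorem isPseudoKernel_iff_exact {k x y : C} (g : k ⟶ x) (f : x ⟶ y) :
    IsPseudoKernel g f ↔ ∃ h : representableMap g ≫ representableMap f = 0,
      (ShortComplex.mk _ _ h).Exact := by
  rw [isPseudoKernel_iff]
  constructor
  · rintro ⟨h₀, h⟩
    have h₀' : representableMap g ≫ representableMap f = 0 := by
      rw [← representableMap_comp, h₀, representableMap_zero]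
    refine ⟨h₀', (ShortComplex.exact_iff_epi_kernel_lift _).2 ?_⟩
    refine epi_of_representable_lift _ fun c z => ?_
    obtain ⟨w, hw⟩ := representableMap_surjective (z ≫ kernel.ι (representableMap f))
    obtain ⟨t, rfl⟩ := h c w <| representableMap_injective <| by
      rw [representableMap_comp, hw, Category.assoc, kernel.condition, comp_zero,
        representableMap_zero]
    refine ⟨representableMap t, (cancel_mono (kernel.ι (representableMap f))).1 ?_⟩
    rw [Category.assoc, kernel.lift_ι, ← hw, representableMap_comp]
  · rintro ⟨h₀, h⟩
    refine ⟨representableMap_injective ?_, fun c t ht => ?_⟩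
    · rw [representableMap_comp, h₀, representableMap_zero]
    · have := (ShortComplex.exact_iff_epi_kernel_lift _).1 h
      have ht' : representableMap t ≫ representableMap f = 0 := by
        rw [← representableMap_comp, ht, representableMap_zero]
      obtain ⟨w, hw⟩ := exists_representable_lift
        (kernel.lift (representableMap f) (representableMap g) h₀) (kernel.lift _ _ ht')
      obtain ⟨s, rfl⟩ := representableMap_surjective w
      refine ⟨s, representableMap_injective ?_⟩
      rw [representableMap_comp]
      simpa using hw =≫ kernel.ι (representableMap f)

theorem exists_representable_extension [HasBinaryBiproducts C] {M : RightModule C} {a b : C}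
    (x : representable a ⟶ M) (y : representable b ⟶ M) : ∃ z : representable (a ⊞ b) ⟶ M,
      representableMap biprod.inl ≫ z = x ∧ representableMap biprod.inr ≫ z = y := by
  refine ⟨representableMap biprod.fst ≫ x + representableMap biprod.snd ≫ y, ?_, ?_⟩ <;>
  simp [Preadditive.comp_add, ← Category.assoc, ← representableMap_comp, representableMap_zero]

section Biproducts

variable [HasFiniteBiproducts C]

/-- Two generators at `a` and `b` merge into one at `a ⊞ b`, so finitely many are merged by
induction. -/
theorem IsTypeFPZero.exists_epi {M : RightModule C} (hM : IsTypeFPZero M) :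
    ∃ (c : C) (p : representable c ⟶ M), Epi p := by
  obtain ⟨n, c, p, _⟩ := hM
  have := hasBinaryBiproducts_of_finite_biproducts C
  have key : ∀ s : Finset (Fin n), ∃ (b : C) (q : representable b ⟶ M), ∀ j ∈ s,
      ∃ t, t ≫ q = Sigma.ι (fun j => representable (c j)) j ≫ p := by
    intro s
    induction s using Finset.induction_on with
    | empty => exact ⟨⨁ fun i : Fin 0 => i.elim0, 0, by simp⟩
    | insert i s _ ih =>
      obtain ⟨b, q, hq⟩ := ih
      obtain ⟨z, hz, hz'⟩ :=
        exists_representable_extension (Sigma.ι (fun j => representable (c j)) i ≫ p) q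
      refine ⟨_, z, fun j hj => ?_⟩
      obtain rfl | hj := Finset.mem_insert.1 hj
      · exact ⟨_, hz⟩
      · obtain ⟨t, ht⟩ := hq j hj
        exact ⟨t ≫ representableMap biprod.inr, by rw [Category.assoc, hz', ht]⟩
  obtain ⟨b, q, hq⟩ := key Finset.univ
  choose t ht using fun j => hq j (Finset.mem_univ j)
  have hp : Sigma.desc t ≫ q = p := Sigma.hom_ext _ _ fun j => by rw [Sigma.ι_desc_assoc, ht]
  subst hp
  exact ⟨b, q, epi_of_epi (Sigma.desc t) q⟩

instance (M : RightModule C) : IsDirectedOrder (GeneralizedElement M) where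
  directed x y := by
    have := hasBinaryBiproducts_of_finite_biproducts C
    obtain ⟨z, hz, hz'⟩ := exists_representable_extension x.hom y.hom
    exact ⟨⟨_, z⟩, ⟨_, hz⟩, ⟨_, hz'⟩⟩

instance (M : RightModule C) : Nonempty (GeneralizedElement M) :=
  ⟨⟨⨁ fun i : Fin 0 => i.elim0, 0⟩⟩

/-- The quotients of a module by its cyclic submodules have colimit zero. -/
noncomputable def isColimitCyclicQuotientsCocone (M : RightModule C) :
    IsColimit (cyclicQuotientsCocone M) where
  desc _ := 0
  fac s x := by
    have hw : ∀ {x y : GeneralizedElement M}, x ≤ y →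
        cyclicQuotientsπ x ≫ s.ι.app x = cyclicQuotientsπ y ≫ s.ι.app y := fun {x y} h => by
      rw [← s.w (homOfLE h), reassoc_of% (cyclicQuotientsπ_map (homOfLE h))]
    rw [comp_zero, ← cancel_epi (cyclicQuotientsπ x), comp_zero]
    refine hom_ext_of_representable fun c y => ?_
    -- Each element `y` dies in the quotient by any `z ≥ y`, so every cocone vanishes.
    obtain ⟨z, hxz, hyz⟩ := exists_ge_ge x (⟨c, y⟩ : GeneralizedElement M)
    rw [comp_zero, hw hxz, reassoc_of% (comp_cyclicQuotientsπ hyz), zero_comp]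
  uniq s m _ := (isZero_zero (RightModule C)).eq_of_src _ _

/-- The quotients of `M` by cyclic submodules form a directed system with colimit zero. Finite
presentability kills the projection from `M` at some stage `y`, and this `y` generates `M`. -/
theorem IsTypeFPOne.isTypeFPZero {M : RightModule C} (hM : IsTypeFPOne M) : IsTypeFPZero M := by
  have : IsFinitelyPresentable.{u} M := hM
  obtain ⟨x⟩ := (inferInstance : Nonempty (GeneralizedElement M))
  obtain ⟨y, f, g, h⟩ := IsFinitelyPresentable.exists_eq_of_isColimit
    (isColimitCyclicQuotientsCocone M) (cyclicQuotientsπ x) (0 : M ⟶ (cyclicQuotients M).obj x)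
    ((isZero_zero (RightModule C)).eq_of_tgt _ _)
  rw [zero_comp, cyclicQuotientsπ_map] at h
  have : Epi y.hom := Abelian.epi_of_cokernel_π_eq_zero _ h
  exact isTypeFPZero_of_epi_representable y.hom

end Biproducts

end FinitenessConditions

/-! ### The Noetherian property as a chain condition. -/

section Noetherian

variable {C : Type u} [SmallCategory C] [Preadditive C]

theorem exists_comp_eq_of_comp_cokernel_eq_zero {c : C} {M N : RightModule C} (y : N ⟶ M)
    (x : representable c ⟶ M) (h : x ≫ cokernel.π y = 0) : ∃ t, t ≫ y = x :=
  ⟨(ShortComplex.exact_cokernel y).liftFromProjective x h,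
    (ShortComplex.exact_cokernel y).liftFromProjective_comp x h⟩

/-- The elements of `S` form a directed family of morphisms into `c`; a largest one generates `S`.
-/
theorem isTypeFPZero_of_mono_representable [HasFiniteBiproducts C] {c : C}
    (hc : HasDirectedACC c) {S : RightModule C} (i : S ⟶ representable c) [Mono i] :
    IsTypeFPZero S := by
  choose f hf using fun x : GeneralizedElement S => representableMap_surjective (x.hom ≫ i)
  obtain ⟨x, hx⟩ := hc (GeneralizedElement S) GeneralizedElement.obj f fun x y hxy => by
    obtain ⟨t, ht⟩ := GeneralizedElement.le_iff.1 hxy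
    obtain ⟨s, rfl⟩ := representableMap_surjective t
    refine ⟨s, representableMap_injective ?_⟩
    rw [representableMap_comp, hf, hf, ← ht, Category.assoc]
  have : Epi x.hom := epi_of_representable_lift _ fun a y => by
    obtain ⟨t, ht⟩ := hx ⟨a, y⟩
    refine ⟨representableMap t, (cancel_mono i).1 ?_⟩
    rw [Category.assoc, ← hf, ← representableMap_comp, ht, hf]
  exact isTypeFPZero_of_epi_representable x.hom

theorem isRightNoetherian_of_hasDirectedACC [HasFiniteBiproducts C]
    (h : ∀ c : C, HasDirectedACC c) : IsRightNoetherian C := by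
  refine fun M hM => ⟨hM, fun S i _ => ?_⟩
  obtain ⟨c, p, _⟩ := hM.exists_epi
  exact (isTypeFPZero_of_mono_representable (h c) (pullback.snd i p)).of_epi (pullback.fst i p)

/-- The kernel of the map from `hom(-, c)` to the colimit of its quotients by the `f i` contains
every `f k`. It has one generator, which already dies at some stage `j`; hence every `f k` factors
through `f j`. -/
theorem IsRightNoetherian.hasDirectedACC [HasFiniteBiproducts C] (h : IsRightNoetherian C)
    (c : C) : HasDirectedACC c := by
  intro I _ _ _ a f hf
  have hmono : Monotone fun i => (⟨a i, representableMap (f i)⟩ :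
      GeneralizedElement (representable c)) := fun i j hij => by
    obtain ⟨t, ht⟩ := hf i j hij
    exact ⟨representableMap t, by rw [← representableMap_comp, ht]⟩
  let Q := hmono.functor ⋙ cyclicQuotients (representable c)
  let π : ∀ i, representable c ⟶ Q.obj i := fun i => cyclicQuotientsπ (hmono.functor.obj i)
  have hπ : ∀ {i j} (g : i ⟶ j), π i ≫ Q.map g = π j := fun g =>
    cyclicQuotientsπ_map (hmono.functor.map g)
  have hπι : ∀ i j, π i ≫ colimit.ι Q i = π j ≫ colimit.ι Q j := fun i j => by
    obtain ⟨k, hik, hjk⟩ := exists_ge_ge i j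
    rw [← colimit.w Q (homOfLE hik), ← colimit.w Q (homOfLE hjk), reassoc_of% hπ (homOfLE hik),
      reassoc_of% hπ (homOfLE hjk)]
  obtain ⟨i⟩ := (inferInstance : Nonempty I)
  obtain ⟨b, q, _⟩ := ((h _ (representable_isTypeFPZero c)).2 (kernel (π i ≫ colimit.ι Q i))
    (kernel.ι _) inferInstance).exists_epi
  have : IsFinitelyPresentable.{u} (representable b) := representable_isTypeFPOne b
  obtain ⟨j, g, g', hj⟩ := IsFinitelyPresentable.exists_eq_of_isColimit (colimit.isColimit Q)
    (q ≫ kernel.ι _ ≫ π i) (0 : _ ⟶ Q.obj i) (by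
      rw [zero_comp, Category.assoc, Category.assoc]
      exact (congrArg (q ≫ ·) (kernel.condition _)).trans comp_zero)
  rw [zero_comp, Category.assoc, Category.assoc, hπ] at hj
  refine ⟨j, fun k => ?_⟩
  have hfk : representableMap (f k) ≫ π i ≫ colimit.ι Q i = 0 := by
    rw [hπι i k, ← Category.assoc]
    have : representableMap (f k) ≫ π k = 0 :=
      comp_cyclicQuotientsπ (le_refl (hmono.functor.obj k))
    rw [this, zero_comp]
  obtain ⟨t, ht⟩ := exists_representable_lift q (kernel.lift _ _ hfk)
  have hk : representableMap (f k) ≫ cokernel.π (representableMap (f j)) = 0 := by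
    rw [← kernel.lift_ι _ _ hfk, ← ht, Category.assoc,
      Category.assoc]
    exact (congrArg (t ≫ ·) hj).trans comp_zero
  obtain ⟨w, hw⟩ := exists_comp_eq_of_comp_cokernel_eq_zero _ _ hk
  obtain ⟨s, rfl⟩ := representableMap_surjective w
  exact ⟨s, representableMap_injective (by rw [representableMap_comp, hw])⟩

end Noetherian

/-! ### Resolutions by representables and dimension shifting. -/

section Resolutions

variable {C : Type u} [SmallCategory C] [Preadditive C]

theorem IsRightNoetherian.exists_representable_kernel [HasFiniteBiproducts C]
    (h : IsRightNoetherian C) {M : RightModule C} {c : C} (p : representable c ⟶ M) :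
    ∃ (b : C) (g : b ⟶ c) (w : representableMap g ≫ p = 0), (ShortComplex.mk _ _ w).Exact := by
  obtain ⟨b, q, _⟩ := ((h _ (representable_isTypeFPZero c)).2 (kernel p) (kernel.ι _)
    inferInstance).exists_epi
  obtain ⟨g, hg⟩ := representableMap_surjective (q ≫ kernel.ι p)
  have w : representableMap g ≫ p = 0 := by rw [hg, Category.assoc, kernel.condition, comp_zero]
  refine ⟨b, g, w, (ShortComplex.exact_iff_epi_kernel_lift _).2 ?_⟩
  have : kernel.lift p (representableMap g) w = q :=
    (cancel_mono (kernel.ι p)).1 (by rw [kernel.lift_ι, hg])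
  simpa only [this]

theorem IsRightNoetherian.isTypeFPOne [HasFiniteBiproducts C] (h : IsRightNoetherian C)
    {M : RightModule C} (hM : IsTypeFPZero M) : IsTypeFPOne M := by
  obtain ⟨c, p, _⟩ := hM.exists_epi
  obtain ⟨b, g, w, hg⟩ := h.exists_representable_kernel p
  have : IsFinitelyPresentable.{u} (cokernel (representableMap g)) := isTypeFPOne_cokernel _
  have : Fact Cardinal.aleph0.{u}.IsRegular := Cardinal.fact_isRegular_aleph0
  let e : cokernel (representableMap g) ≅ M :=
    (cokernelIsCokernel _).coconePointUniqueUpToIso hg.gIsCokernel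
  exact isCardinalPresentable_of_iso e _

theorem IsRightNoetherian.isRightCoherent [HasFiniteBiproducts C] (h : IsRightNoetherian C) :
    IsRightCoherent C :=
  fun _ hM => ⟨hM, fun _ _ _ hS => h.isTypeFPOne hS⟩

theorem IsRightNoetherian.exists_isPseudoInfinityKernel [HasFiniteBiproducts C]
    (h : IsRightNoetherian C) {x y : C} (g : x ⟶ y) :
    ∃ (X : ℕ → C) (f : ∀ n, X (n + 1) ⟶ X n), IsPseudoInfinityKernel X f ∧
      ∃ (e : X 0 = y) (e' : X 1 = x), f 0 = eqToHom e' ≫ g ≫ eqToHom e.symm := by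
  have hk : ∀ {x y : C} (g : x ⟶ y), ∃ (k : C) (f : k ⟶ x), IsPseudoKernel f g := fun g => by
    obtain ⟨k, f, hf⟩ := h.exists_representable_kernel (representableMap g)
    exact ⟨k, f, (isPseudoKernel_iff_exact f g).2 hf⟩
  choose k f hf using @hk
  -- The state carries a morphism with its source and target, since each step changes both objects.
  let s : ℕ → Σ p : C × C, p.1 ⟶ p.2 := fun n =>
    n.rec ⟨(x, y), g⟩ fun _ t => ⟨(k t.2, t.1.1), f t.2⟩
  exact ⟨fun n => (s n).1.2, fun n => (s n).2, fun n => hf (s n).2, rfl, rfl, by simp [s]⟩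

/-- The cokernel of the map on representable modules induced by a morphism of a chain. -/
noncomputable abbrev cosyzygy {X : ℕ → C} (f : ∀ n, X (n + 1) ⟶ X n) (n : ℕ) : RightModule C :=
  cokernel (representableMap (f n))

section

variable {X : ℕ → C} {f : ∀ n, X (n + 1) ⟶ X n} (hf : IsPseudoInfinityKernel X f)

include hf

/-- Exactness at `X (n + 1)` identifies `coker (f (n + 1))` with the image of `f n`. -/
theorem IsPseudoInfinityKernel.exists_shortExact (n : ℕ) :
    ∃ (i : cosyzygy f (n + 1) ⟶ representable (X n))
      (w : i ≫ cokernel.π (representableMap (f n)) = 0),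
      cokernel.π _ ≫ i = representableMap (f n) ∧ (ShortComplex.mk _ _ w).ShortExact := by
  obtain ⟨w, h⟩ := (isPseudoKernel_iff_exact _ _).1 (hf n)
  have hw : cokernel.desc _ _ w ≫ cokernel.π (representableMap (f n)) = 0 :=
    (cancel_epi (cokernel.π _)).1 (by simp)
  refine ⟨cokernel.desc _ _ w, hw, cokernel.π_desc _ _ _, ?_⟩
  have : Mono (cokernel.desc _ _ w) := h.mono_cokernelDesc
  let φ : ShortComplex.mk _ _ (cokernel.condition (representableMap (f n))) ⟶
      ShortComplex.mk _ _ hw :=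
    { τ₁ := cokernel.π _
      τ₂ := 𝟙 _
      τ₃ := 𝟙 _ }
  have : Epi φ.τ₁ := inferInstanceAs (Epi (cokernel.π _))
  have : IsIso φ.τ₂ := inferInstanceAs (IsIso (𝟙 _))
  have : Mono φ.τ₃ := inferInstanceAs (Mono (𝟙 _))
  exact { exact := (ShortComplex.exact_iff_of_epi_of_isIso_of_mono φ).1
            (ShortComplex.exact_cokernel _) }

/-- The bound starts at `k + 2` because a projective `coker (f n)` does not force the next cokernel
to vanish. -/
theorem IsPseudoInfinityKernel.hasProjectiveDimensionLT_iff (n k : ℕ) :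
    HasProjectiveDimensionLT (cosyzygy f n) (k + 2) ↔
      HasProjectiveDimensionLT (cosyzygy f (n + 1)) (k + 1) := by
  obtain ⟨i, w, -, h⟩ := hf.exists_shortExact n
  exact h.hasProjectiveDimensionLT_X₃_iff k (representable_projective _)

theorem IsPseudoInfinityKernel.hasProjectiveDimensionLT_zero_iff (n : ℕ) :
    HasProjectiveDimensionLT (cosyzygy f 0) (n + 1) ↔ Projective (cosyzygy f n) := by
  rw [projective_iff_hasProjectiveDimensionLT_one]
  -- The starting index is generalized so that each induction step can shift it.
  have : ∀ k, HasProjectiveDimensionLT (cosyzygy f k) (n + 1) ↔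
      HasProjectiveDimensionLT (cosyzygy f (k + n)) 1 := by
    induction n with
    | zero => exact fun _ => Iff.rfl
    | succ n ih =>
      intro k
      rw [hf.hasProjectiveDimensionLT_iff, ih, show k + 1 + n = k + (n + 1) by omega]
  simpa using this 0

theorem IsPseudoInfinityKernel.projective_iff (n : ℕ) :
    Projective (cosyzygy f (n + 1)) ↔
      -- `α` is the projection onto the cokernel followed by a section.
      ∃ α : X (n + 1) ⟶ X (n + 1), α ≫ f n = f n ∧ f (n + 1) ≫ α = 0 := by
  obtain ⟨i, w, hi, h⟩ := hf.exists_shortExact n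
  have : Mono i := h.mono_f
  constructor
  · intro _
    obtain ⟨α, hα⟩ := representableMap_surjective
      (cokernel.π (representableMap (f (n + 1))) ≫
        Projective.factorThru (𝟙 _) (cokernel.π (representableMap (f (n + 1)))))
    refine ⟨α, representableMap_injective ?_, representableMap_injective ?_⟩
    · rw [representableMap_comp, hα, ← hi]
      simp
    · rw [representableMap_comp, hα, cokernel.condition_assoc, zero_comp, representableMap_zero]
  · rintro ⟨α, hα, hα'⟩
    have w' : representableMap (f (n + 1)) ≫ representableMap α = 0 := by
      rw [← representableMap_comp, hα', representableMap_zero]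
    refine Retract.projective (Y := representable (X (n + 1)))
      ⟨cokernel.desc _ (representableMap α) w', cokernel.π _, ?_⟩
    -- After embedding by `i`, the retract identity becomes `α ≫ f n = f n`.
    rw [← cancel_epi (cokernel.π _), ← cancel_mono i, cokernel.π_desc_assoc]
    simp only [Category.assoc, Category.comp_id, hi, ← representableMap_comp, hα]

end

end Resolutions

end RightRegular

theorem mainTheorem8 (C : Type u) [SmallCategory C] [Preadditive C] [HasFiniteBiproducts C] :
    RightRegular.IsRightRegular C ↔
      (∀ c : C, RightRegular.HasDirectedACC c) ∧ RightRegular.AlphaSplitting C := by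
  constructor
  · rintro ⟨hN, -, hd⟩
    refine ⟨hN.hasDirectedACC, fun X f hf => ?_⟩
    obtain ⟨n, hn⟩ := hd (RightRegular.cosyzygy f 0) (RightRegular.isTypeFPOne_cokernel _)
    -- The bound is raised to `n + 2` because the splitting criterion concerns only cokernels of
    -- index at least one.
    have := hasProjectiveDimensionLT_of_ge (RightRegular.cosyzygy f 0) n (n + 2) (by omega)
    exact ⟨n, (hf.projective_iff n).1 ((hf.hasProjectiveDimensionLT_zero_iff (n + 1)).1 this)⟩
  · rintro ⟨hA, hS⟩
    have hN := RightRegular.isRightNoetherian_of_hasDirectedACC hA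
    refine ⟨hN, hN.isRightCoherent, fun M hM => ?_⟩
    obtain ⟨c, p, _⟩ := hM.isTypeFPZero.exists_epi
    obtain ⟨b, g, w, hg⟩ := hN.exists_representable_kernel p
    obtain ⟨X, f, hf, rfl, rfl, hfg⟩ := hN.exists_isPseudoInfinityKernel g
    obtain rfl : f 0 = g := by simpa using hfg
    obtain ⟨m, hm⟩ := hS X f hf
    have := (hf.hasProjectiveDimensionLT_zero_iff (m + 1)).2 ((hf.projective_iff m).2 hm)
    let e : RightRegular.cosyzygy f 0 ≅ M :=
      (cokernelIsCokernel _).coconePointUniqueUpToIso hg.gIsCokernel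
    exact ⟨m + 2, hasProjectiveDimensionLT_of_iso e _⟩
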